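/- For an algebraic number $x$, let $\overline{|x|}$ (the house of $x$) denote the maximum of the absolute values of the conjugates of $x$. Let $D,M$ be positive integers, let $\gamma\in(0,1)$, let $\mathbb K\subset\mathbb C$ be a number field of degree $D$ over $\mathbb Q$, and set $d=\max(2,DM-1)$. For $j=1,\dots,M$ and $n\ge 1$ let $S_{n,j}\in\mathbb Z$, let $b_{n,j},c_{n,j},d_{n,j}\in\mathbb K$ be algebraic integers with $d_{n,j}\ne0$, and suppose that $$a_{n,j}=\frac{S_{n,j}b_{n,j}+c_{n,j}}{d_{n,j}}$$ is a real number with $a_{n,j}\ge 1$; let also $a_{0,j}\in\mathbb K$ be real. Suppose that for all $n\ge1$ and all $j=1,\dots,M$ $$a_{n,1}<\max\bigl(a_{n,M}2^{(\log_2 a_{n,M})^\gamma},\,2^{d^{n\gamma}}\bigr),\qquad \overline{|b_{n,j}|},\ \overline{|c_{n,j}|},\ \overline{|d_{n,j}|}\le\max\bigl(2^{(\log_2 a_{n,j})^\gamma},\,2^{d^{n\gamma}}\bigr),$$ that $$\liminf_{n\to\infty}\sqrt n\Bigl(\frac{a_{n,j}}{a_{n,j+1}}-1\Bigr)>0\qquad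 (j=1,\dots,M-1),$$ and that for some $j\in\{1,\dots,M\}$ $$\limsup_{n\to\infty}a_{n,j}^{1/d^n}=\infty .$$ Suppose finally that at least one of the following two conditions holds: (i) $\overline{|1/a_{n,j}|}\le\frac12$ for all $n\ge1$ and all $j$; (ii) for every $j$ and every embedding $\sigma:\mathbb K\to\mathbb C$ there is $e_{j,\sigma}\in\{0,1\}$, not depending on $n$, such that for all $n\ge 1$ $$(-1)^{e_{j,\sigma}}\,\Re(\sigma a_{n,j})\ \ge\ \max\bigl(2^{(\log_2 a_{n,1})^\gamma},\,2^{d^{n\gamma}}\bigr)^{-1}.$$ Then the continued fractions $\alpha_j=[a_{0,j};a_{1,j},a_{2,j},\dots]$, $j=1,\dots,M$, converge, and the numbers $\alpha_1,\dots,\alpha_M$ and $1$ are linearly independent over $\mathbb K$. -/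

import Mathlib

open Filter Topology NumberField

/-- The simple continued fraction `[a 0; a 1, a 2, …]` with real partial quotients, as a Mathlib
generalized continued fraction all of whose partial numerators are `1`. -/
noncomputable def contFrac (a : ℕ → ℝ) : GenContFract ℝ where
  h := a 0
  s := Stream'.Seq.ofStream fun n => ⟨1, a (n + 1)⟩

/-- `x = [a 0; a 1, a 2, …]`: the convergents of the continued fraction tend to `x`. -/
def IsContFracValue (a : ℕ → ℝ) (x : ℝ) : Prop :=
  Tendsto (contFrac a).convs atTop (𝓝 x)

/-- The quantity `max (2 ^ ((log₂ x) ^ γ), 2 ^ (d ^ (n γ)))`. -/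
noncomputable def growthBound (d : ℕ) (γ : ℝ) (n : ℕ) (x : ℝ) : ℝ :=
  max ((2 : ℝ) ^ (Real.logb 2 x ^ γ)) ((2 : ℝ) ^ ((d : ℝ) ^ ((n : ℝ) * γ)))

/-!
The proof is a Liouville-type argument for the norm of an algebraic integer.

Let `x j i = a (i + 1) j`, let `p_N / q_N` be the convergents of `[0; x j 0, x j 1, …]` and `l j`
their limit. A relation `β₀ + ∑ β j l j = 0` over `K` may be taken with integral coefficients. With
the limits replaced by the `N`-th convergents, it gives an element of `K` that becomes an algebraic
integer `z` after multiplication by all `q_N` and all denominators `den (i + 1) j`, `i < N`.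

* `z ≠ 0` for large `N`. The `liminf` hypothesis makes `q_N` for `j` grow faster than `q_N` for
  `j' > j` (`tendsto_contDen_div_contDen`), so that among the errors `β j (l j - p_N / q_N)`, each of
  the exact order `β j / (q_N q_{N+1})`, the last nonzero one dominates
  (`eventually_sum_mul_sub_ne_zero`).
* Every conjugate of `z` is bounded by a constant times the `M`-th power of the product of the
  partial quotients, up to factors of subexponential size. The integer `S n j` is controlled by
  `a n j` because the nonzero algebraic integer `b n j` of small house cannot be too small
  (`norm_mul_norm_add_one_le`). The value of `z` itself is smaller by a factor `q_N q_{N+1}`.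

As the norm of `z` is at least one, `mul_prod_sq_le_of_relation` bounds the next partial quotients.
By `exists_abs_logb_sub_le` the sequences `x j` agree up to small factors, so with
`L i = log₂ (x j i)` for the last `j` this reads
`L N ≤ (D M - 2) ∑_{i < N} L i + C ∑_{i < N} ((L i) ^ γ + d ^ ((i + 1) γ))`. Since `D M - 2 ≤ d - 1`
and `γ < 1`, the recursion implies `L N = O(d ^ N)` (`exists_le_mul_pow_of_le_sum`): the sums
`∑_{i < N} L i` divided by `d ^ N` grow by factors `1 + ε N` with summable `ε`. Hence
`a n j ^ (1 / d ^ n)` is bounded for every `j`, against the `limsup` hypothesis.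
-/

/-! ### Continuants -/

/-- The denominators of the convergents of `[0; x 0, x 1, …]`. The partial quotients are indexed
from `0`, so `contDen x n` involves `x 0, …, x (n - 1)`. -/
def contDen {R : Type*} [Semiring R] (x : ℕ → R) : ℕ → R
  | 0 => 1
  | 1 => x 0
  | n + 2 => x (n + 1) * contDen x (n + 1) + contDen x n

/-- The numerators of the convergents of `[0; x 0, x 1, …]`. -/
def contNum {R : Type*} [Semiring R] (x : ℕ → R) : ℕ → R
  | 0 => 0
  | 1 => 1
  | n + 2 => x (n + 1) * contNum x (n + 1) + contNum x n

theorem map_contDen {R R' : Type*} [Semiring R] [Semiring R'] (f : R →+* R') (x : ℕ → R) (n : ℕ) :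
    f (contDen x n) = contDen (fun i => f (x i)) n := by
  induction n using Nat.twoStepInduction with
  | zero => simp [contDen]
  | one => simp [contDen]
  | more n h1 h2 => simp [contDen, h1, h2]

theorem map_contNum {R R' : Type*} [Semiring R] [Semiring R'] (f : R →+* R') (x : ℕ → R) (n : ℕ) :
    f (contNum x n) = contNum (fun i => f (x i)) n := by
  induction n using Nat.twoStepInduction with
  | zero => simp [contNum]
  | one => simp [contNum]
  | more n h1 h2 => simp [contNum, h1, h2]

theorem norm_contDen_le (x : ℕ → ℂ) (n : ℕ) :
    ‖contDen x n‖ ≤ ∏ i ∈ Finset.range n, (‖x i‖ + 1) := by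
  induction n using Nat.twoStepInduction with
  | zero => simp [contDen]
  | one => simp [contDen]
  | more n h1 h2 =>
    have hP : 0 ≤ ∏ i ∈ Finset.range n, (‖x i‖ + 1) := Finset.prod_nonneg fun i _ => by positivity
    have hn : ∏ i ∈ Finset.range n, (‖x i‖ + 1) ≤ ∏ i ∈ Finset.range (n + 1), (‖x i‖ + 1) := by
      rw [Finset.prod_range_succ]
      exact le_mul_of_one_le_right hP (by linarith [norm_nonneg (x n)])
    rw [Finset.prod_range_succ _ (n + 1)]
    calc ‖contDen x (n + 2)‖ ≤ ‖x (n + 1)‖ * ‖contDen x (n + 1)‖ + ‖contDen x n‖ := by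
          rw [contDen, ← norm_mul]; exact norm_add_le _ _
      _ ≤ ‖x (n + 1)‖ * (∏ i ∈ Finset.range (n + 1), (‖x i‖ + 1))
            + ∏ i ∈ Finset.range (n + 1), (‖x i‖ + 1) := by
          gcongr; exact h1.trans hn
      _ = _ := by ring

theorem norm_contNum_le (x : ℕ → ℂ) (n : ℕ) :
    ‖contNum x n‖ ≤ ∏ i ∈ Finset.range n, (‖x i‖ + 1) := by
  induction n using Nat.twoStepInduction with
  | zero => simp [contNum]
  | one => simp [contNum]
  | more n h1 h2 =>
    have hP : 0 ≤ ∏ i ∈ Finset.range n, (‖x i‖ + 1) := Finset.prod_nonneg fun i _ => by positivity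
    have hn : ∏ i ∈ Finset.range n, (‖x i‖ + 1) ≤ ∏ i ∈ Finset.range (n + 1), (‖x i‖ + 1) := by
      rw [Finset.prod_range_succ]
      exact le_mul_of_one_le_right hP (by linarith [norm_nonneg (x n)])
    rw [Finset.prod_range_succ _ (n + 1)]
    calc ‖contNum x (n + 2)‖ ≤ ‖x (n + 1)‖ * ‖contNum x (n + 1)‖ + ‖contNum x n‖ := by
          rw [contNum, ← norm_mul]; exact norm_add_le _ _
      _ ≤ ‖x (n + 1)‖ * (∏ i ∈ Finset.range (n + 1), (‖x i‖ + 1))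
            + ∏ i ∈ Finset.range (n + 1), (‖x i‖ + 1) := by
          gcongr; exact h1.trans hn
      _ = _ := by ring

theorem isIntegral_prod_mul_contDen {F : Type*} [Field F] (δ x : ℕ → F)
    (hδ : ∀ i, IsIntegral ℤ (δ i)) (hx : ∀ i, IsIntegral ℤ (δ i * x i)) (n : ℕ) :
    IsIntegral ℤ ((∏ i ∈ Finset.range n, δ i) * contDen x n) := by
  induction n using Nat.twoStepInduction with
  | zero => simpa [contDen] using isIntegral_one
  | one => simpa [contDen] using hx 0
  | more n h1 h2 =>
    have e : (∏ i ∈ Finset.range (n + 2), δ i) * contDen x (n + 2) =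
        δ (n + 1) * x (n + 1) * ((∏ i ∈ Finset.range (n + 1), δ i) * contDen x (n + 1)) +
          δ (n + 1) * δ n * ((∏ i ∈ Finset.range n, δ i) * contDen x n) := by
      rw [contDen, Finset.prod_range_succ, Finset.prod_range_succ]
      ring
    rw [e]
    exact ((hx (n + 1)).mul h2).add (((hδ (n + 1)).mul (hδ n)).mul h1)

theorem isIntegral_prod_mul_contNum {F : Type*} [Field F] (δ x : ℕ → F)
    (hδ : ∀ i, IsIntegral ℤ (δ i)) (hx : ∀ i, IsIntegral ℤ (δ i * x i)) (n : ℕ) :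
    IsIntegral ℤ ((∏ i ∈ Finset.range n, δ i) * contNum x n) := by
  induction n using Nat.twoStepInduction with
  | zero => simpa [contNum] using isIntegral_zero
  | one => simpa [contNum] using hδ 0
  | more n h1 h2 =>
    have e : (∏ i ∈ Finset.range (n + 2), δ i) * contNum x (n + 2) =
        δ (n + 1) * x (n + 1) * ((∏ i ∈ Finset.range (n + 1), δ i) * contNum x (n + 1)) +
          δ (n + 1) * δ n * ((∏ i ∈ Finset.range n, δ i) * contNum x n) := by
      rw [contNum, Finset.prod_range_succ, Finset.prod_range_succ]
      ring
    rw [e]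
    exact ((hx (n + 1)).mul h2).add (((hδ (n + 1)).mul (hδ n)).mul h1)

theorem contNum_mul_contDen_sub {R : Type*} [CommRing R] (x : ℕ → R) (n : ℕ) :
    contNum x (n + 1) * contDen x n - contNum x n * contDen x (n + 1) = (-1) ^ n := by
  induction n with
  | zero => simp [contNum, contDen]
  | succ n ih =>
    rw [pow_succ, ← ih]
    simp only [contNum, contDen]
    ring

/-! ### Convergence of continued fractions with real partial quotients at least one -/

theorem one_le_contDen {x : ℕ → ℝ} (hx : ∀ i, 1 ≤ x i) (n : ℕ) : 1 ≤ contDen x n := by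
  induction n using Nat.twoStepInduction with
  | zero => simp [contDen]
  | one => simpa [contDen] using hx 0
  | more n h1 h2 => rw [contDen]; nlinarith [hx (n + 1)]

theorem mul_contDen_le_succ {x : ℕ → ℝ} (hx : ∀ i, 1 ≤ x i) (n : ℕ) :
    x n * contDen x n ≤ contDen x (n + 1) := by
  cases n with
  | zero => simp [contDen]
  | succ n => rw [contDen]; linarith [one_le_contDen hx n]

theorem contDen_le_succ {x : ℕ → ℝ} (hx : ∀ i, 1 ≤ x i) (n : ℕ) :
    contDen x n ≤ contDen x (n + 1) :=
  (le_mul_of_one_le_left (by linarith [one_le_contDen hx n]) (hx n)).trans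
    (mul_contDen_le_succ hx n)

theorem prod_le_contDen {x : ℕ → ℝ} (hx : ∀ i, 1 ≤ x i) (n : ℕ) :
    ∏ i ∈ Finset.range n, x i ≤ contDen x n := by
  induction n with
  | zero => simp [contDen]
  | succ n ih =>
    rw [Finset.prod_range_succ, mul_comm]
    exact (mul_le_mul_of_nonneg_left ih (by linarith [hx n])).trans (mul_contDen_le_succ hx n)

theorem natCast_le_contDen {x : ℕ → ℝ} (hx : ∀ i, 1 ≤ x i) (n : ℕ) : (n : ℝ) ≤ contDen x n := by
  induction n using Nat.twoStepInduction with
  | zero => simp [contDen]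
  | one => simpa [contDen] using hx 0
  | more n h1 h2 =>
    rw [contDen]
    push_cast at *
    nlinarith [hx (n + 1), one_le_contDen hx n]

/-- The convergents `contNum / contDen` are the partial sums of an alternating series, which gives
their limit together with the classical two-sided bound for the error. -/
theorem exists_contFrac_limit {x : ℕ → ℝ} (hx : ∀ i, 1 ≤ x i) :
    ∃ l : ℝ, Tendsto (fun n => contNum x n / contDen x n) atTop (𝓝 l) ∧
      ∀ n, |l - contNum x n / contDen x n| ≤ 1 / (contDen x n * contDen x (n + 1)) ∧
        1 / (2 * (contDen x n * contDen x (n + 1))) ≤ |l - contNum x n / contDen x n| := by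
  set q := contDen x with hq
  have q1 : ∀ n, 1 ≤ q n := one_le_contDen hx
  have qpos : ∀ n, 0 < q n := fun n => by linarith [q1 n]
  have qs : ∀ n, q n ≤ q (n + 1) := contDen_le_succ hx
  set f : ℕ → ℝ := fun n => 1 / (q n * q (n + 1)) with hf
  have fanti : Antitone f := antitone_nat_of_succ_le fun n => by
    simp only [hf]
    apply one_div_le_one_div_of_le (mul_pos (qpos _) (qpos _))
    exact mul_le_mul (qs _) (qs _) (qpos _).le (qpos _).le
  have f0 : Tendsto f atTop (𝓝 0) := by
    refine squeeze_zero' (g := fun n : ℕ => 1 / (n : ℝ)) (Eventually.of_forall fun n => ?_) ?_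
      tendsto_one_div_atTop_nhds_zero_nat
    · have := qpos n; have := qpos (n + 1); positivity
    · filter_upwards [eventually_gt_atTop 0] with n hn
      apply one_div_le_one_div_of_le (by exact_mod_cast hn)
      have := natCast_le_contDen hx n
      nlinarith [q1 n, q1 (n + 1)]
  have hsum : ∀ n, ∑ i ∈ Finset.range n, (-1) ^ i * f i = contNum x n / q n := by
    intro n
    induction n with
    | zero => simp [contNum]
    | succ n ih =>
      rw [Finset.sum_range_succ, ih, ← contNum_mul_contDen_sub x n]
      have := (qpos n).ne'; have := (qpos (n + 1)).ne'
      simp only [hf, ← hq]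
      field_simp
      ring
  obtain ⟨l, hl⟩ := cauchySeq_tendsto_of_complete
    (fanti.cauchySeq_alternating_series_of_tendsto_zero f0)
  have hfhalf : ∀ n, f n / 2 ≤ f n - f (n + 1) := by
    intro n
    have h1 : q (n + 2) = x (n + 1) * q (n + 1) + q n := by simp [hq, contDen]
    have h2 : f (n + 1) ≤ f n / 2 := by
      simp only [hf]
      rw [div_div]
      apply one_div_le_one_div_of_le (by have := qpos n; have := qpos (n + 1); positivity)
      have : q n * 2 ≤ q (n + 2) := by rw [h1]; nlinarith [hx (n + 1), qs n, qpos (n + 1)]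
      nlinarith [qpos (n + 1)]
    linarith
  have hlow : ∀ k, ∑ i ∈ Finset.range (2 * k), (-1) ^ i * f i ≤ l :=
    fanti.alternating_series_le_tendsto hl
  have hupp : ∀ k, l ≤ ∑ i ∈ Finset.range (2 * k + 1), (-1) ^ i * f i :=
    fanti.tendsto_le_alternating_series hl
  have key : ∀ n, f n / 2 ≤ |l - contNum x n / q n| ∧ |l - contNum x n / q n| ≤ f n := by
    intro n
    rw [← hsum n]
    have h0 := hfhalf n
    rcases Nat.even_or_odd' n with ⟨k, rfl | rfl⟩
    · have e1 := hlow (k + 1)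
      have e2 := hupp k
      have e3 := hlow k
      rw [show 2 * (k + 1) = 2 * k + 1 + 1 by ring, Finset.sum_range_succ,
        Finset.sum_range_succ] at e1
      rw [Finset.sum_range_succ] at e2
      have s1 : (-1 : ℝ) ^ (2 * k + 1) = -1 := by simp [pow_succ, pow_mul]
      have s2 : (-1 : ℝ) ^ (2 * k) = 1 := by simp [pow_mul]
      rw [s1, s2] at e1
      rw [s2] at e2
      rw [abs_of_nonneg (by linarith)]
      constructor <;> linarith
    · have e1 := hupp (k + 1)
      have e2 := hlow (k + 1)
      have e3 := hupp k
      rw [show 2 * (k + 1) + 1 = 2 * k + 1 + 1 + 1 by ring, Finset.sum_range_succ,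
        Finset.sum_range_succ] at e1
      rw [show 2 * (k + 1) = 2 * k + 1 + 1 by ring, Finset.sum_range_succ] at e2
      have s1 : (-1 : ℝ) ^ (2 * k + 1) = -1 := by simp [pow_succ, pow_mul]
      have s2 : (-1 : ℝ) ^ (2 * k + 1 + 1) = 1 := by simp [pow_succ, pow_mul]
      rw [s1, s2] at e1
      rw [s1] at e2
      rw [abs_of_nonpos (by linarith)]
      constructor <;> linarith
  refine ⟨l, by simpa only [hsum] using hl, fun n => ⟨(key n).2, ?_⟩⟩
  calc 1 / (2 * (q n * q (n + 1))) = f n / 2 := by simp only [hf]; rw [div_div, mul_comm]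
    _ ≤ _ := (key n).1

theorem contFrac_dens (a : ℕ → ℝ) (n : ℕ) :
    (contFrac a).dens n = contDen (fun i => a (i + 1)) n := by
  induction n using Nat.twoStepInduction with
  | zero => simp [contDen]
  | one => exact GenContFract.first_den_eq (gp := ⟨1, a 1⟩) rfl
  | more n h1 h2 =>
    rw [GenContFract.dens_recurrence (gp := ⟨1, a (n + 2)⟩) rfl h1 h2]
    simp [contDen]

theorem contFrac_nums (a : ℕ → ℝ) (n : ℕ) :
    (contFrac a).nums n =
      a 0 * contDen (fun i => a (i + 1)) n + contNum (fun i => a (i + 1)) n := by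
  induction n using Nat.twoStepInduction with
  | zero => simp [contDen, contNum, contFrac]
  | one =>
    rw [GenContFract.first_num_eq (gp := ⟨1, a 1⟩) rfl]
    simp [contDen, contNum, contFrac, mul_comm]
  | more n h1 h2 =>
    rw [GenContFract.nums_recurrence (gp := ⟨1, a (n + 2)⟩) rfl h1 h2]
    simp only [contDen, contNum]
    ring

theorem isContFracValue_add {a : ℕ → ℝ} (ha : ∀ i, 1 ≤ a (i + 1)) {l : ℝ}
    (hl : Tendsto (fun n => contNum (fun i => a (i + 1)) n / contDen (fun i => a (i + 1)) n)
      atTop (𝓝 l)) :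
    IsContFracValue a (a 0 + l) := by
  refine (hl.const_add (a 0)).congr fun n => ?_
  rw [GenContFract.conv_eq_num_div_den, contFrac_nums, contFrac_dens]
  have := one_le_contDen ha n
  field_simp

/-! ### Comparison of two continued fractions -/

/-- If `x i ≥ (1 + κ / √(i + 1)) * y i` eventually, then the denominators belonging to `x` grow
faster than those belonging to `y`: the minimum of two consecutive ratios increases by a factor
`1 + κ / (2 √(i + 1))` every second step. -/
theorem tendsto_contDen_div_contDen {x y : ℕ → ℝ} (hx : ∀ i, 1 ≤ x i) (hy : ∀ i, 1 ≤ y i)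
    {κ : ℝ} (hκ : 0 < κ) (h : ∀ᶠ i : ℕ in atTop, (1 + κ / √((i : ℝ) + 1)) * y i ≤ x i) :
    Tendsto (fun n => contDen x n / contDen y n) atTop atTop := by
  obtain ⟨n0, hn0⟩ := eventually_atTop.1 h
  have px : ∀ n, 0 < contDen x n := fun n => by linarith [one_le_contDen hx n]
  have py : ∀ n, 0 < contDen y n := fun n => by linarith [one_le_contDen hy n]
  set ρ : ℕ → ℝ := fun n => contDen x n / contDen y n with hρ
  have ρpos : ∀ n, 0 < ρ n := fun n => div_pos (px n) (py n)
  -- lower bounds for two consecutive ratios improve for all later ones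
  have step : ∀ n, n0 ≤ n → ∀ t, 0 ≤ t → t ≤ ρ n → t ≤ ρ (n + 1) →
      (1 + κ / √((n : ℝ) + 2) / 2) * t ≤ ρ (n + 2) := by
    intro n hn t ht h1 h2
    have hxy := hn0 (n + 1) (by omega)
    push_cast at hxy
    rw [add_assoc, one_add_one_eq_two] at hxy
    set ε := κ / √((n : ℝ) + 2)
    have hε : 0 ≤ ε := by positivity
    simp only [hρ] at h1 h2 ⊢
    rw [le_div_iff₀ (py _)] at h1 h2 ⊢
    have e0 := contDen_le_succ hy n
    simp only [contDen]
    have hy1 := hy (n + 1)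
    have p1 := py (n + 1)
    have p0 := py n
    have e1 : (1 + ε) * y (n + 1) * (t * contDen y (n + 1)) ≤ x (n + 1) * contDen x (n + 1) := by
      apply mul_le_mul hxy h2 (by positivity) (by linarith [hx (n + 1)])
    have e2 : ε / 2 * t * contDen y n ≤ ε / 2 * t * (y (n + 1) * contDen y (n + 1)) := by
      gcongr
      nlinarith
    nlinarith
  have step' : ∀ n, n0 ≤ n → ∀ t, 0 ≤ t → t ≤ ρ n → t ≤ ρ (n + 1) → t ≤ ρ (n + 2) := by
    intro n hn t ht h1 h2
    refine le_trans ?_ (step n hn t ht h1 h2)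
    apply le_mul_of_one_le_left ht
    have : 0 ≤ κ / √((n : ℝ) + 2) / 2 := by positivity
    linarith
  set m := min (ρ n0) (ρ (n0 + 1)) with hm
  have mpos : 0 < m := lt_min (ρpos _) (ρpos _)
  have grow : ∀ k N : ℕ, n0 + 2 * k ≤ N → N ≤ n0 + 2 * k + 1 →
      ∀ i, N ≤ i → m + k * (κ / √((n0 : ℝ) + 2 * k + 2) / 2 * m) ≤ ρ i := by
    have pairs : ∀ (n : ℕ) (t : ℝ), n0 ≤ n → 0 ≤ t → t ≤ ρ n → t ≤ ρ (n + 1) →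
        ∀ i, n ≤ i → t ≤ ρ i := by
      intro n t hn ht h1 h2 i hi
      obtain ⟨k, rfl⟩ := Nat.exists_eq_add_of_le hi
      induction k using Nat.twoStepInduction with
      | zero => exact h1
      | one => exact h2
      | more k i1 i2 =>
        exact step' (n + k) (by omega) t ht (i1 (by omega)) (i2 (by omega))
    have main : ∀ k : ℕ, ∃ t, m + k * (κ / √((n0 : ℝ) + 2 * k + 2) / 2 * m) ≤ t ∧ m ≤ t ∧
        t ≤ ρ (n0 + 2 * k) ∧ t ≤ ρ (n0 + 2 * k + 1) := by
      intro k
      induction k with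
      | zero => exact ⟨m, by simp, le_rfl, min_le_left _ _, min_le_right _ _⟩
      | succ k ih =>
        obtain ⟨t, ht, hmt, h1, h2⟩ := ih
        have h0t : 0 ≤ t := mpos.le.trans hmt
        have h3 := step (n0 + 2 * k) (by omega) t h0t h1 h2
        have h4 := step (n0 + 2 * k + 1) (by omega) t h0t h2
          (step' (n0 + 2 * k) (by omega) t h0t h1 h2)
        push_cast at h3 h4 ⊢
        have hs : ∀ u : ℝ, 0 < u → u ≤ n0 + 2 * (k + 1) + 2 →
            κ / √((n0 : ℝ) + 2 * (k + 1) + 2) ≤ κ / √u := by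
          intro u hu hle
          have := Real.sqrt_pos.2 hu
          gcongr
        set δ := κ / √((n0 : ℝ) + 2 * (k + 1) + 2) with hδ
        have hδ0 : 0 ≤ δ := by positivity
        have d1 := hs (n0 + 2 * k + 2) (by positivity) (by linarith)
        have d2 := hs (n0 + 2 * k + 1 + 2) (by positivity) (by linarith)
        refine ⟨(1 + δ / 2) * t, ?_, ?_, ?_, ?_⟩
        · have c1 : (k : ℝ) * (δ / 2 * m) ≤ k * (κ / √((n0 : ℝ) + 2 * k + 2) / 2 * m) := by
            gcongr
          have c2 : δ / 2 * m ≤ δ / 2 * t := by gcongr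
          nlinarith
        · nlinarith
        · refine le_trans ?_ h3
          gcongr
        · refine le_trans ?_ h4
          gcongr
    intro k N hN hN' i hi
    obtain ⟨t, ht, hmt, h1, h2⟩ := main k
    exact ht.trans (pairs (n0 + 2 * k) t (by omega) (mpos.le.trans hmt) h1 h2 i (by omega))
  -- `k / √(n0 + 2 k + 2)` tends to infinity
  rw [tendsto_atTop]
  intro B
  have hlim : Tendsto (fun k : ℕ => √((n0 : ℝ) + 2 * k + 2)) atTop atTop := by
    apply Real.tendsto_sqrt_atTop.comp
    apply tendsto_atTop_add_const_right
    apply tendsto_atTop_add_const_left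
    exact tendsto_natCast_atTop_atTop.const_mul_atTop two_pos
  have hlim2 : ∀ᶠ k : ℕ in atTop, B ≤ k * (κ / √((n0 : ℝ) + 2 * k + 2) / 2 * m) := by
    filter_upwards [hlim.eventually_ge_atTop (8 * |B| / (κ * m)), eventually_ge_atTop (n0 + 2)]
      with k hk hk2
    have hs : 0 < √((n0 : ℝ) + 2 * k + 2) := Real.sqrt_pos.2 (by positivity)
    have hsq := Real.sq_sqrt (show (0 : ℝ) ≤ (n0 : ℝ) + 2 * k + 2 by positivity)
    set s := √((n0 : ℝ) + 2 * k + 2)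
    have hk3 : s ^ 2 ≤ 4 * k := by
      have : ((n0 + 2 : ℕ) : ℝ) ≤ k := by exact_mod_cast hk2
      push_cast at this
      rw [hsq]; linarith
    rw [div_le_iff₀ (by positivity)] at hk
    calc B ≤ |B| := le_abs_self B
      _ ≤ s * (κ * m) / 8 := by linarith
      _ = s ^ 2 / 4 * (κ / s / 2 * m) := by field_simp; norm_num
      _ ≤ _ := by gcongr; linarith
  obtain ⟨k, hk⟩ := hlim2.exists
  filter_upwards [eventually_ge_atTop (n0 + 2 * k)] with i hi
  linarith [grow k (n0 + 2 * k) le_rfl (by omega) i hi]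

/-! ### A growth recursion -/

theorem exists_bound_of_le_one_add_mul {u ε : ℕ → ℝ} (hu : ∀ n, 0 ≤ u n) (hε0 : ∀ n, 0 ≤ ε n)
    (hεs : Summable ε) {n0 : ℕ} (h : ∀ n, n0 ≤ n → u (n + 1) ≤ (1 + ε n) * u n) :
    ∃ B, 0 ≤ B ∧ ∀ n, n0 ≤ n → u n ≤ B := by
  have ubound : ∀ k, u (n0 + k) ≤ u n0 * Real.exp (∑ i ∈ Finset.range k, ε (n0 + i)) := by
    intro k
    induction k with
    | zero => simp
    | succ k ih =>
      rw [Finset.sum_range_succ, Real.exp_add]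
      calc u (n0 + (k + 1)) ≤ (1 + ε (n0 + k)) * u (n0 + k) := h _ (Nat.le_add_right _ _)
        _ ≤ Real.exp (ε (n0 + k)) * (u n0 * Real.exp (∑ i ∈ Finset.range k, ε (n0 + i))) := by
            apply mul_le_mul _ ih (hu _) (Real.exp_pos _).le
            linarith [Real.add_one_le_exp (ε (n0 + k))]
        _ = _ := by ring
  have hεs' : Summable fun i => ε (n0 + i) := by
    simpa only [add_comm] using (summable_nat_add_iff n0).2 hεs
  have h0 := hu n0
  refine ⟨u n0 * Real.exp (∑' i, ε (n0 + i)), by positivity, fun n hn => ?_⟩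
  obtain ⟨k, rfl⟩ := Nat.exists_eq_add_of_le hn
  refine (ubound k).trans ?_
  have := hεs'.sum_le_tsum (Finset.range k) (fun i _ => hε0 _)
  gcongr

/-- The error term of the recursion in `exists_le_mul_pow_of_le_sum`, measured against
`1 + d⁻ᴺ ∑_{i < N} L i`. -/
theorem sum_rpow_add_rpow_le {d : ℕ} (hd : 2 ≤ d) {γ : ℝ} (hγ0 : 0 < γ) (hγ1 : γ < 1)
    {L : ℕ → ℝ} (hL : ∀ i, 0 ≤ L i) (N : ℕ) :
    ∑ i ∈ Finset.range N, (L i ^ γ + (d : ℝ) ^ (((i : ℝ) + 1) * γ)) ≤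
      2 * N * ((d : ℝ) ^ (γ - 1)) ^ N * (d : ℝ) ^ N *
        (1 + (∑ i ∈ Finset.range N, L i) / (d : ℝ) ^ N) := by
  have hd' : (2 : ℝ) ≤ d := by exact_mod_cast hd
  have hd0 : (0 : ℝ) < d := by linarith
  have hT0 : 0 ≤ ∑ i ∈ Finset.range N, L i := Finset.sum_nonneg fun i _ => hL i
  have hrN : (d : ℝ) ^ ((N : ℝ) * γ) = ((d : ℝ) ^ (γ - 1)) ^ N * (d : ℝ) ^ N := by
    rw [← Real.rpow_natCast, ← Real.rpow_mul hd0.le, ← Real.rpow_natCast, ← Real.rpow_add hd0]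
    ring_nf
  have hr0 : 0 < (d : ℝ) ^ (γ - 1) := by positivity
  have hu1 : 1 ≤ 1 + (∑ i ∈ Finset.range N, L i) / (d : ℝ) ^ N := by
    have : 0 ≤ (∑ i ∈ Finset.range N, L i) / (d : ℝ) ^ N := by positivity
    linarith
  have h2 : ∀ i ∈ Finset.range N,
      L i ≤ (d : ℝ) ^ N * (1 + (∑ i ∈ Finset.range N, L i) / (d : ℝ) ^ N) := by
    intro i hi
    have h3 := Finset.single_le_sum (f := L) (fun i _ => hL i) hi
    rw [mul_add, mul_div_cancel₀ _ (by positivity)]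
    have : 0 ≤ (d : ℝ) ^ N := by positivity
    linarith
  generalize 1 + (∑ i ∈ Finset.range N, L i) / (d : ℝ) ^ N = u at *
  generalize (d : ℝ) ^ (γ - 1) = r at *
  have hterm : ∀ i ∈ Finset.range N, L i ^ γ + (d : ℝ) ^ (((i : ℝ) + 1) * γ) ≤
      2 * (r ^ N * (d : ℝ) ^ N * u) := by
    intro i hi
    have hiN : i + 1 ≤ N := Finset.mem_range.1 hi
    have h1 : (d : ℝ) ^ (((i : ℝ) + 1) * γ) ≤ r ^ N * (d : ℝ) ^ N := by
      rw [← hrN]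
      apply Real.rpow_le_rpow_of_exponent_le (by linarith)
      gcongr
      exact_mod_cast hiN
    have h3 : L i ^ γ ≤ r ^ N * (d : ℝ) ^ N * u := by
      calc L i ^ γ ≤ ((d : ℝ) ^ N * u) ^ γ := Real.rpow_le_rpow (hL i) (h2 i hi) hγ0.le
        _ = r ^ N * (d : ℝ) ^ N * u ^ γ := by
            rw [Real.mul_rpow (by positivity) (by linarith), ← hrN, Real.rpow_mul hd0.le,
              Real.rpow_natCast]
        _ ≤ r ^ N * (d : ℝ) ^ N * u ^ (1 : ℝ) := by
            gcongr
        _ = _ := by rw [Real.rpow_one]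
    have h4 : r ^ N * (d : ℝ) ^ N ≤ r ^ N * (d : ℝ) ^ N * u :=
      le_mul_of_one_le_right (by positivity) hu1
    linarith
  refine (Finset.sum_le_sum hterm).trans (le_of_eq ?_)
  rw [Finset.sum_const, Finset.card_range, nsmul_eq_mul]
  ring

/-- A sequence with `L N ≤ (d - 1) ∑_{i < N} L i + error`, where the error is of the order of
`∑_{i < N} ((L i) ^ γ + d ^ ((i + 1) γ))` with `γ < 1`, is `O(d ^ N)`. -/
theorem exists_le_mul_pow_of_le_sum {d : ℕ} (hd : 2 ≤ d) {γ : ℝ} (hγ0 : 0 < γ) (hγ1 : γ < 1)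
    {L : ℕ → ℝ} (hL : ∀ i, 0 ≤ L i) {C : ℝ}
    (h : ∀ᶠ N : ℕ in atTop, L N ≤ ((d : ℝ) - 1) * ∑ i ∈ Finset.range N, L i +
      C * ∑ i ∈ Finset.range N, (L i ^ γ + (d : ℝ) ^ (((i : ℝ) + 1) * γ))) :
    ∃ B : ℝ, ∀ N, L N ≤ B * (d : ℝ) ^ N := by
  obtain ⟨n0, hn0⟩ := eventually_atTop.1 h
  have hd' : (2 : ℝ) ≤ d := by exact_mod_cast hd
  have hd0 : (0 : ℝ) < d := by linarith
  obtain ⟨T, hT⟩ : ∃ T : ℕ → ℝ, ∀ N, T N = ∑ i ∈ Finset.range N, L i := ⟨_, fun _ => rfl⟩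
  have hT0 : ∀ N, 0 ≤ T N := fun N => hT N ▸ Finset.sum_nonneg fun i _ => hL i
  have hTs : ∀ N, T (N + 1) = T N + L N := fun N => by rw [hT, hT, Finset.sum_range_succ]
  have herr := sum_rpow_add_rpow_le hd hγ0 hγ1 hL
  simp only [← hT] at herr hn0
  obtain ⟨r, hr⟩ : ∃ r : ℝ, r = (d : ℝ) ^ (γ - 1) := ⟨_, rfl⟩
  have hr0 : 0 < r := hr ▸ Real.rpow_pos_of_pos hd0 _
  have hr1 : r < 1 := hr ▸ Real.rpow_lt_one_of_one_lt_of_neg (by linarith) (by linarith)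
  obtain ⟨u, hu⟩ : ∃ u : ℕ → ℝ, ∀ N, u N = 1 + T N / (d : ℝ) ^ N := ⟨_, fun _ => rfl⟩
  simp only [← hr, ← hu] at herr
  have hu1 : ∀ N, 1 ≤ u N := fun N => by
    have := hT0 N
    have : 0 ≤ T N / (d : ℝ) ^ N := by positivity
    rw [hu]; linarith
  obtain ⟨ε, hε⟩ : ∃ ε : ℕ → ℝ, ∀ N : ℕ, ε N = 2 * |C| * ((N : ℝ) ^ 1 * r ^ N) :=
    ⟨_, fun _ => rfl⟩
  have hε0 : ∀ N, 0 ≤ ε N := fun N => by rw [hε]; positivity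
  have hεs : Summable ε := by
    have hs : Summable fun N : ℕ => (N : ℝ) ^ 1 * r ^ N :=
      summable_pow_mul_geometric_of_norm_lt_one 1 (by rwa [Real.norm_of_nonneg hr0.le])
    have hs' := hs.mul_left (2 * |C|)
    exact hs'.congr fun N => (hε N).symm
  have ustep : ∀ N, n0 ≤ N → u (N + 1) ≤ (1 + ε N) * u N := by
    intro N hN
    have h1 := hn0 N hN
    have hs0 : 0 ≤ ∑ i ∈ Finset.range N, (L i ^ γ + (d : ℝ) ^ (((i : ℝ) + 1) * γ)) :=
      Finset.sum_nonneg fun i _ => add_nonneg (Real.rpow_nonneg (hL i) _) (by positivity)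
    have e1 := mul_le_mul (le_abs_self C) (herr N) hs0 (abs_nonneg C)
    have h2 : T (N + 1) ≤ d * T N + ε N * u N * (d : ℝ) ^ N := by
      have e2 : ε N * u N * (d : ℝ) ^ N = |C| * (2 * N * r ^ N * (d : ℝ) ^ N * u N) := by
        rw [hε]; ring
      rw [hTs, e2]
      linarith
    have hdN : 0 < (d : ℝ) ^ N := by positivity
    have e3 : T (N + 1) / (d : ℝ) ^ (N + 1) ≤ T N / (d : ℝ) ^ N + ε N * u N := by
      rw [div_le_iff₀ (by positivity), pow_succ]
      have e4 : (T N / (d : ℝ) ^ N + ε N * u N) * ((d : ℝ) ^ N * d) =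
          d * T N + ε N * u N * (d : ℝ) ^ N * d := by
        have := hdN.ne'
        field_simp
      rw [e4]
      have e5 : 0 ≤ ε N * u N * (d : ℝ) ^ N :=
        mul_nonneg (mul_nonneg (hε0 N) (by linarith [hu1 N])) hdN.le
      have e6 := le_mul_of_one_le_right e5 (show (1 : ℝ) ≤ d by linarith)
      linarith
    calc u (N + 1) = 1 + T (N + 1) / (d : ℝ) ^ (N + 1) := hu _
      _ ≤ 1 + (T N / (d : ℝ) ^ N + ε N * u N) := by linarith
      _ = (1 + ε N) * u N := by rw [hu]; ring
  obtain ⟨B1, hB10, hB1'⟩ := exists_bound_of_le_one_add_mul (fun n => by linarith [hu1 n]) hε0 hεs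
    ustep
  have hTB : ∀ N, n0 ≤ N → T N ≤ B1 * (d : ℝ) ^ N := by
    intro N hN
    have h1 := hB1' N hN
    have h2 : T N / (d : ℝ) ^ N ≤ B1 := by
      have := hu N
      linarith
    rwa [div_le_iff₀ (by positivity)] at h2
  refine ⟨B1 * d + T n0, fun N => ?_⟩
  have hdN : 1 ≤ (d : ℝ) ^ N := one_le_pow₀ (by linarith)
  have hTn := hT0 n0
  rcases le_or_gt n0 N with hN | hN
  · have h1 := hTB (N + 1) (by omega)
    have h2 := hTs N
    have h3 := hT0 N
    rw [pow_succ] at h1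
    nlinarith
  · have h1 : L N ≤ T n0 := hT n0 ▸ Finset.single_le_sum (f := L) (fun i _ => hL i) (Finset.mem_range.2 hN)
    have : 0 ≤ B1 * d * (d : ℝ) ^ N := by positivity
    nlinarith

/-! ### Estimates for conjugates -/

theorem one_le_norm_mul_pow_of_isIntegral {K : Type*} [Field K] [NumberField K] {z : K}
    (hz : IsIntegral ℤ z) (hz0 : z ≠ 0) (φ : K →+* ℂ) {B : ℝ} (hB : ∀ σ : K →+* ℂ, ‖σ z‖ ≤ B) :
    1 ≤ ‖φ z‖ * B ^ (Module.finrank ℚ K - 1) := by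
  have hhouse : house z ≤ B := by
    have hB0 : 0 ≤ B := (norm_nonneg _).trans (hB φ)
    rw [house, pi_norm_le_iff_of_nonneg hB0]
    exact hB
  have h1 : 1 ≤ ‖Algebra.norm ℚ z‖ := by
    obtain ⟨m, hm⟩ := IsIntegrallyClosed.isIntegral_iff.1 (Algebra.isIntegral_norm ℚ hz)
    have hm0 : m ≠ 0 := by
      rintro rfl
      rw [map_zero, eq_comm, Algebra.norm_eq_zero_iff] at hm
      exact hz0 hm
    rw [← hm, eq_intCast, ← Rat.norm_cast_real, Rat.cast_intCast, Real.norm_eq_abs]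
    exact_mod_cast Int.one_le_abs hm0
  refine h1.trans ((norm_norm_le_norm_mul_house_pow z φ).trans ?_)
  gcongr
  exact house_nonneg z

/-- If `x = (s b + c) / δ` has absolute value at least one under one embedding `φ`, then no conjugate
of `x` is much larger than `φ x`: the integer `s` is controlled by `φ x` because `φ b` is not too
small. -/
theorem norm_mul_norm_add_one_le {K : Type*} [Field K] [NumberField K] {x : K} {s : ℤ}
    {b c δ : 𝓞 K} (hx : x = ((s : K) * (b : K) + (c : K)) / (δ : K)) (φ : K →+* ℂ)
    (hφ : 1 ≤ ‖φ x‖) {G : ℝ} (hG : 1 ≤ G) (hb : house (b : K) ≤ G) (hc : house (c : K) ≤ G)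
    (hδ : house (δ : K) ≤ G) (σ : K →+* ℂ) :
    ‖σ δ‖ * (‖σ x‖ + 1) ≤ 4 * ‖φ x‖ * G ^ (Module.finrank ℚ K + 1) := by
  have hδ0 : (δ : K) ≠ 0 := by
    intro h0
    rw [h0, div_zero] at hx
    rw [hx, map_zero, norm_zero] at hφ
    linarith
  have hmul : (δ : K) * x = (s : K) * (b : K) + (c : K) := by
    rw [hx]; field_simp
  have emb : ∀ (τ : K →+* ℂ) (y : K), house y ≤ G → ‖τ y‖ ≤ G := fun τ y hy =>
    (norm_embedding_le_house y τ).trans hy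
  have key : ∀ τ : K →+* ℂ, τ δ * τ x = s * τ b + τ c := by
    intro τ
    rw [← map_mul, hmul, map_add, map_mul, map_intCast]
  obtain ⟨k, hk⟩ : ∃ k, Module.finrank ℚ K = k + 1 :=
    Nat.exists_eq_succ_of_ne_zero Module.finrank_pos.ne'
  have hGk : 1 ≤ G ^ (k + 1) := one_le_pow₀ hG
  have hsb : ‖(s : ℂ)‖ * ‖σ b‖ ≤ 2 * ‖φ x‖ * G ^ (k + 2) := by
    by_cases hb0 : (b : K) = 0
    · rw [hb0, map_zero, norm_zero, mul_zero]; positivity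
    have h1 : ‖(s : ℂ)‖ * ‖φ b‖ ≤ 2 * ‖φ x‖ * G := by
      have : (s : ℂ) * φ b = φ δ * φ x - φ c := by rw [key φ]; ring
      rw [← norm_mul, this]
      refine (norm_sub_le _ _).trans ?_
      rw [norm_mul]
      have h2 := emb φ c hc
      have h3 := mul_le_mul_of_nonneg_right (emb φ δ hδ) (norm_nonneg (φ x))
      nlinarith
    have h2 := one_le_norm_mul_pow_of_isIntegral b.isIntegral_coe hb0 φ fun τ => emb τ _ hb
    rw [hk, Nat.add_sub_cancel] at h2
    calc ‖(s : ℂ)‖ * ‖σ b‖ ≤ ‖(s : ℂ)‖ * (‖φ b‖ * G ^ k) * G := by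
          apply mul_le_mul (le_mul_of_one_le_right (norm_nonneg _) h2) (emb σ b hb)
            (norm_nonneg _) (by positivity)
      _ = ‖(s : ℂ)‖ * ‖φ b‖ * G ^ (k + 1) := by ring
      _ ≤ 2 * ‖φ x‖ * G * G ^ (k + 1) := by gcongr
      _ = _ := by ring
  have hGle : G ≤ ‖φ x‖ * G ^ (k + 2) := by
    calc G = 1 * (1 * G) := by ring
      _ ≤ ‖φ x‖ * (G ^ (k + 1) * G) := by gcongr
      _ = _ := by ring
  rw [mul_add, ← norm_mul, key σ, mul_one, hk]
  have h5 : ‖(s : ℂ) * σ b + σ c‖ ≤ ‖(s : ℂ)‖ * ‖σ b‖ + G := by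
    refine (norm_add_le _ _).trans ?_
    rw [norm_mul]
    gcongr
    exact emb σ c hc
  have h6 := emb σ δ hδ
  have e : k + 1 + 1 = k + 2 := rfl
  rw [e]
  linarith

/-! ### The linear form is nonzero -/

/-- If the denominators of one continued fraction grow faster than those of the next, then the
last term with nonzero coefficient dominates the linear form in the approximation errors. -/
theorem eventually_sum_mul_sub_ne_zero {M : ℕ} {x : Fin M → ℕ → ℝ} (hx : ∀ j i, 1 ≤ x j i)
    {α : Fin M → ℝ}
    (hα : ∀ j n, |α j - contNum (x j) n / contDen (x j) n| ≤
        1 / (contDen (x j) n * contDen (x j) (n + 1)) ∧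
      1 / (2 * (contDen (x j) n * contDen (x j) (n + 1))) ≤
        |α j - contNum (x j) n / contDen (x j) n|)
    (hgrow : ∀ j j' : Fin M, j < j' →
      Tendsto (fun n => contDen (x j) n / contDen (x j') n) atTop atTop)
    {β : Fin M → ℂ} (hβ : ∃ j, β j ≠ 0) :
    ∀ᶠ n in atTop, ∑ j, β j * ((α j - contNum (x j) n / contDen (x j) n : ℝ) : ℂ) ≠ 0 := by
  classical
  obtain ⟨j0, hj0, hmax⟩ : ∃ j0, β j0 ≠ 0 ∧ ∀ j, j0 < j → β j = 0 := by
    obtain ⟨j1, hj1⟩ := hβ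
    have hne : (Finset.univ.filter fun j => β j ≠ 0).Nonempty := ⟨j1, by simpa using hj1⟩
    refine ⟨_, (Finset.mem_filter.1 (Finset.max'_mem _ hne)).2, fun j hj => ?_⟩
    by_contra hne'
    exact absurd (Finset.le_max' _ j (by simpa using hne')) (not_le.2 hj)
  set E : Fin M → ℕ → ℝ := fun j n => α j - contNum (x j) n / contDen (x j) n with hE
  have qpos : ∀ j n, 0 < contDen (x j) n := fun j n => by linarith [one_le_contDen (hx j) n]
  have small : ∀ j, j ≠ j0 → ∀ᶠ n in atTop,
      ‖β j‖ * |E j n| ≤ ‖β j0‖ * |E j0 n| / (M + 1) := by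
    intro j hj
    rcases lt_or_gt_of_ne hj with hlt | hgt
    · have hb : 0 < ‖β j0‖ := norm_pos_iff.2 hj0
      set R := max 1 (2 * (M + 1) * ‖β j‖ / ‖β j0‖) with hR
      have ev := (hgrow j j0 hlt).eventually_ge_atTop R
      filter_upwards [ev, (tendsto_add_atTop_nat 1).eventually ev] with n h1 h2
      have hR1 : 1 ≤ R := le_max_left _ _
      have hR2 : 2 * (M + 1) * ‖β j‖ ≤ R * ‖β j0‖ := by
        rw [← div_le_iff₀ hb]; exact le_max_right _ _
      rw [le_div_iff₀ (qpos _ _)] at h1 h2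
      have u1 := (hα j n).1
      have l1 := (hα j0 n).2
      have hqq : R * (contDen (x j0) n * contDen (x j0) (n + 1)) ≤
          contDen (x j) n * contDen (x j) (n + 1) := by
        have p1 := qpos j0 n
        have p2 := qpos j0 (n + 1)
        calc R * (contDen (x j0) n * contDen (x j0) (n + 1))
            ≤ (R * contDen (x j0) n) * (R * contDen (x j0) (n + 1)) := by
              have : 0 ≤ R * (contDen (x j0) n * contDen (x j0) (n + 1)) := by positivity
              nlinarith
          _ ≤ _ := mul_le_mul h1 h2 (by positivity) (qpos _ _).le
      have p : 0 < contDen (x j0) n * contDen (x j0) (n + 1) := mul_pos (qpos _ _) (qpos _ _)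
      generalize contDen (x j0) n * contDen (x j0) (n + 1) = Q at *
      have hRpos : 0 < R := by linarith
      rw [le_div_iff₀ (by positivity)]
      calc ‖β j‖ * |E j n| * (M + 1) ≤ ‖β j‖ * (1 / (R * Q)) * (M + 1) := by
            gcongr
            exact u1.trans (one_div_le_one_div_of_le (by positivity) hqq)
        _ = 2 * (M + 1) * ‖β j‖ / R * (1 / (2 * Q)) := by field_simp
        _ ≤ ‖β j0‖ * |E j0 n| := by
            apply mul_le_mul _ l1 (by positivity) (norm_nonneg _)
            rw [div_le_iff₀ hRpos]; linarith
    · refine Eventually.of_forall fun n => ?_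
      rw [hmax j hgt, norm_zero, zero_mul]
      positivity
  have small' : ∀ᶠ n in atTop, ∀ j, j ≠ j0 →
      ‖β j‖ * |E j n| ≤ ‖β j0‖ * |E j0 n| / (M + 1) :=
    eventually_all.2 fun j => by
      by_cases h : j = j0
      · simp [h]
      · simpa [h] using small j h
  filter_upwards [small'] with n hn hzero
  rw [← Finset.add_sum_erase _ _ (Finset.mem_univ j0), add_eq_zero_iff_eq_neg] at hzero
  have hpos : 0 < ‖β j0‖ * |E j0 n| := by
    apply mul_pos (norm_pos_iff.2 hj0)
    have := qpos j0 n; have := qpos j0 (n + 1)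
    exact lt_of_lt_of_le (by positivity) (hα j0 n).2
  have hle : ‖β j0‖ * |E j0 n| ≤ M * (‖β j0‖ * |E j0 n| / (M + 1)) := by
    calc ‖β j0‖ * |E j0 n| = ‖β j0 * (E j0 n : ℂ)‖ := by
          rw [norm_mul, Complex.norm_real, Real.norm_eq_abs]
      _ = ‖∑ j ∈ Finset.univ.erase j0, β j * (E j n : ℂ)‖ := by rw [hzero, norm_neg]
      _ ≤ ∑ j ∈ Finset.univ.erase j0, ‖β j0‖ * |E j0 n| / (M + 1) := by
          apply norm_sum_le_of_le
          intro j hj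
          rw [norm_mul, Complex.norm_real, Real.norm_eq_abs]
          exact hn j (Finset.ne_of_mem_erase hj)
      _ ≤ M * (‖β j0‖ * |E j0 n| / (M + 1)) := by
          rw [Finset.sum_const, nsmul_eq_mul]
          gcongr
          exact_mod_cast (Finset.card_le_univ _).trans_eq (Fintype.card_fin M)
  rw [mul_div_assoc', le_div_iff₀ (by positivity)] at hle
  nlinarith

/-! ### The norm inequality -/

/-- The Liouville-type inequality behind the theorem. Replacing each limit `α j` in the relation
`β₀ + ∑ β j α j = 0` by the `N`-th convergent and clearing denominators gives an algebraic integer.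
When it is nonzero, its norm is at least one, which bounds the next partial quotients. Here `W i`
bounds the conjugates and `V i`, `v` bound the partial quotients from below. -/
theorem mul_prod_sq_le_of_relation {K : Type*} [Field K] [NumberField K] (φ : K →+* ℂ) {M : ℕ}
    {x δ : Fin M → ℕ → K} {xr : Fin M → ℕ → ℝ} (hφ : ∀ j i, φ (x j i) = (xr j i : ℂ))
    (hxr : ∀ j i, 1 ≤ xr j i) (hδ0 : ∀ j i, δ j i ≠ 0) (hδ : ∀ j i, IsIntegral ℤ (δ j i))
    (hδx : ∀ j i, IsIntegral ℤ (δ j i * x j i)) {α : Fin M → ℝ}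
    (hα : ∀ j n, |α j - contNum (xr j) n / contDen (xr j) n| ≤
        1 / (contDen (xr j) n * contDen (xr j) (n + 1)))
    {β0 : K} {β : Fin M → K} (hβ0 : IsIntegral ℤ β0) (hβ : ∀ j, IsIntegral ℤ (β j))
    (hrel : φ β0 + ∑ j, φ (β j) * (α j : ℂ) = 0)
    {V W : ℕ → ℝ} (hV : ∀ i, 0 < V i) (hVx : ∀ j i, V i ≤ xr j i)
    (hW : ∀ (σ : K →+* ℂ) j i, ‖σ (δ j i)‖ * (‖σ (x j i)‖ + 1) ≤ W i)
    {B : ℝ} (hB : house β0 + ∑ j, house (β j) ≤ B)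
    {N : ℕ} (hN : ∑ j, φ (β j) * ((α j - contNum (xr j) N / contDen (xr j) N : ℝ) : ℂ) ≠ 0)
    {v : ℝ} (hv : 0 < v) (hvx : ∀ j, v ≤ xr j N) :
    v * (∏ i ∈ Finset.range N, V i) ^ 2 ≤
      (B * (∏ i ∈ Finset.range N, W i) ^ M) ^ Module.finrank ℚ K := by
  classical
  set R : Fin M → K := fun j => ∏ i ∈ Finset.range N, δ j i with hR
  set Q : Fin M → K := fun j => R j * contDen (x j) N with hQ
  set P : Fin M → K := fun j => R j * contNum (x j) N with hP
  set w := ∏ i ∈ Finset.range N, W i with hw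
  set z : K := β0 * ∏ j, Q j + ∑ j, β j * (P j * ∏ i ∈ Finset.univ.erase j, Q i) with hz
  have hBnn : 0 ≤ B := (add_nonneg (house_nonneg _)
    (Finset.sum_nonneg fun j _ => house_nonneg _)).trans hB
  have hQint : ∀ j, IsIntegral ℤ (Q j) := fun j =>
    isIntegral_prod_mul_contDen _ _ (hδ j) (hδx j) N
  have hPint : ∀ j, IsIntegral ℤ (P j) := fun j =>
    isIntegral_prod_mul_contNum _ _ (hδ j) (hδx j) N
  have hzint : IsIntegral ℤ z :=
    (hβ0.mul (IsIntegral.prod _ fun j _ => hQint j)).add <| IsIntegral.sum _ fun j _ =>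
      (hβ j).mul ((hPint j).mul (IsIntegral.prod _ fun i _ => hQint i))
  have hprod : ∀ (σ : K →+* ℂ) j,
      (∏ i ∈ Finset.range N, ‖σ (δ j i)‖) * ∏ i ∈ Finset.range N, (‖σ (x j i)‖ + 1) ≤ w := by
    intro σ j
    rw [← Finset.prod_mul_distrib]
    exact Finset.prod_le_prod (fun i _ => by positivity) fun i _ => hW σ j i
  have hQle : ∀ (σ : K →+* ℂ) j, ‖σ (Q j)‖ ≤ w := by
    intro σ j
    refine le_trans ?_ (hprod σ j)
    simp only [hQ, hR]
    rw [map_mul, norm_mul, map_prod, norm_prod, map_contDen]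
    gcongr
    exact norm_contDen_le _ _
  have hPle : ∀ (σ : K →+* ℂ) j, ‖σ (P j)‖ ≤ w := by
    intro σ j
    refine le_trans ?_ (hprod σ j)
    simp only [hP, hR]
    rw [map_mul, norm_mul, map_prod, norm_prod, map_contNum]
    gcongr
    exact norm_contNum_le _ _
  have hprodle : ∀ σ : K →+* ℂ, ‖σ (∏ j, Q j)‖ ≤ w ^ M := by
    intro σ
    rw [map_prod, norm_prod]
    refine (Finset.prod_le_prod (fun _ _ => norm_nonneg _) fun j _ => hQle σ j).trans_eq ?_
    rw [Finset.prod_const, Finset.card_univ, Fintype.card_fin]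
  have hzle : ∀ σ : K →+* ℂ, ‖σ z‖ ≤ B * w ^ M := by
    intro σ
    have hterm : ∀ j, ‖σ (β j * (P j * ∏ i ∈ Finset.univ.erase j, Q i))‖ ≤
        house (β j) * w ^ M := by
      intro j
      rw [map_mul, norm_mul]
      refine mul_le_mul (norm_embedding_le_house _ _) ?_ (norm_nonneg _) (house_nonneg _)
      rw [map_mul, norm_mul, map_prod, norm_prod]
      have hwj : w ^ M = ∏ i : Fin M, w := by simp
      rw [hwj, ← Finset.mul_prod_erase _ _ (Finset.mem_univ j)]
      exact mul_le_mul (hPle σ j) (Finset.prod_le_prod (fun _ _ => norm_nonneg _)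
        fun i _ => hQle σ i) (Finset.prod_nonneg fun _ _ => norm_nonneg _)
        ((norm_nonneg _).trans (hPle σ j))
    have hwM : 0 ≤ w ^ M := (norm_nonneg _).trans (hprodle σ)
    calc ‖σ z‖ ≤ ‖σ (β0 * ∏ j, Q j)‖ +
          ∑ j, ‖σ (β j * (P j * ∏ i ∈ Finset.univ.erase j, Q i))‖ := by
            rw [hz, map_add, map_sum]
            exact (norm_add_le _ _).trans (add_le_add le_rfl (norm_sum_le _ _))
      _ ≤ house β0 * w ^ M + ∑ j, house (β j) * w ^ M := by
            refine add_le_add ?_ (Finset.sum_le_sum fun j _ => hterm j)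
            rw [map_mul, norm_mul]
            exact mul_le_mul (norm_embedding_le_house _ _) (hprodle σ) (norm_nonneg _)
              (house_nonneg _)
      _ = (house β0 + ∑ j, house (β j)) * w ^ M := by rw [← Finset.sum_mul, ← add_mul]
      _ ≤ B * w ^ M := by gcongr
  set q : Fin M → ℝ := fun j => contDen (xr j) N with hq
  set p : Fin M → ℝ := fun j => contNum (xr j) N with hp
  have qpos : ∀ j, 0 < q j := fun j => by
    have := one_le_contDen (hxr j) N
    simp only [hq]; linarith
  have hden : ∀ j, φ (contDen (x j) N) = (q j : ℂ) := by
    intro j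
    rw [map_contDen]
    simp only [hφ]
    exact (map_contDen Complex.ofRealHom (xr j) N).symm
  have hnum : ∀ j, φ (contNum (x j) N) = (p j : ℂ) := by
    intro j
    rw [map_contNum]
    simp only [hφ]
    exact (map_contNum Complex.ofRealHom (xr j) N).symm
  set Λ : ℂ := ∑ j, φ (β j) * ((α j - p j / q j : ℝ) : ℂ) with hΛ
  have hφz : φ z = φ (∏ j, Q j) * -Λ := by
    have hPQ : ∀ j, φ (P j) = φ (Q j) * ((p j / q j : ℝ) : ℂ) := by
      intro j
      have : (q j : ℂ) ≠ 0 := by exact_mod_cast (qpos j).ne'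
      simp only [hP, hQ]
      rw [map_mul, map_mul, hnum, hden]
      push_cast
      field_simp
    have hsum : φ (∑ j, β j * (P j * ∏ i ∈ Finset.univ.erase j, Q i)) =
        φ (∏ j, Q j) * ∑ j, φ (β j) * ((p j / q j : ℝ) : ℂ) := by
      rw [map_sum, Finset.mul_sum]
      refine Finset.sum_congr rfl fun j _ => ?_
      rw [← Finset.mul_prod_erase _ _ (Finset.mem_univ j), map_mul φ (β j),
        map_mul φ (P j), map_mul φ (Q j), hPQ]
      ring
    have hΛ' : Λ = ∑ j, φ (β j) * (α j : ℂ) - ∑ j, φ (β j) * ((p j / q j : ℝ) : ℂ) := by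
      rw [hΛ, ← Finset.sum_sub_distrib]
      refine Finset.sum_congr rfl fun j _ => ?_
      push_cast
      ring
    rw [hz, map_add, hsum, map_mul, hΛ', ← neg_eq_of_add_eq_zero_right hrel]
    ring
  have hVpos : 0 < ∏ i ∈ Finset.range N, V i := Finset.prod_pos fun i _ => hV i
  have hΛle : ‖Λ‖ ≤ B / (v * (∏ i ∈ Finset.range N, V i) ^ 2) := by
    have hterm : ∀ j, ‖φ (β j) * ((α j - p j / q j : ℝ) : ℂ)‖ ≤
        house (β j) * (1 / (v * (∏ i ∈ Finset.range N, V i) ^ 2)) := by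
      intro j
      rw [norm_mul, Complex.norm_real, Real.norm_eq_abs]
      refine mul_le_mul (norm_embedding_le_house _ _) ((hα j N).trans ?_) (abs_nonneg _)
        (house_nonneg _)
      apply one_div_le_one_div_of_le (by positivity)
      have h1 : ∏ i ∈ Finset.range N, V i ≤ contDen (xr j) N :=
        (Finset.prod_le_prod (fun i _ => (hV i).le) fun i _ => hVx j i).trans
          (prod_le_contDen (hxr j) N)
      have h2 : v * ∏ i ∈ Finset.range N, V i ≤ contDen (xr j) (N + 1) :=
        (mul_le_mul (hvx j) h1 hVpos.le (by linarith [hxr j N])).trans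
          (mul_contDen_le_succ (hxr j) N)
      calc v * (∏ i ∈ Finset.range N, V i) ^ 2
          = (∏ i ∈ Finset.range N, V i) * (v * ∏ i ∈ Finset.range N, V i) := by ring
        _ ≤ _ := mul_le_mul h1 h2 (by positivity) (qpos j).le
    calc ‖Λ‖ ≤ ∑ j, house (β j) * (1 / (v * (∏ i ∈ Finset.range N, V i) ^ 2)) :=
          norm_sum_le_of_le _ fun j _ => hterm j
      _ = (∑ j, house (β j)) / (v * (∏ i ∈ Finset.range N, V i) ^ 2) := by
          rw [← Finset.sum_mul, mul_one_div]
      _ ≤ _ := by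
          gcongr
          linarith [house_nonneg β0]
  have hz0 : z ≠ 0 := by
    intro h0
    rw [h0, map_zero, eq_comm, mul_eq_zero, neg_eq_zero] at hφz
    rcases hφz with h1 | h1
    · rw [map_eq_zero, Finset.prod_eq_zero_iff] at h1
      obtain ⟨j, -, hj⟩ := h1
      rcases mul_eq_zero.1 hj with h2 | h2
      · obtain ⟨i, -, hi⟩ := Finset.prod_eq_zero_iff.1 h2
        exact hδ0 j i hi
      · have h3 := hden j
        rw [h2, map_zero] at h3
        exact (qpos j).ne (by exact_mod_cast h3)
    · exact hN h1
  have hone := one_le_norm_mul_pow_of_isIntegral hzint hz0 φ hzle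
  obtain ⟨k, hk⟩ : ∃ k, Module.finrank ℚ K = k + 1 :=
    Nat.exists_eq_succ_of_ne_zero Module.finrank_pos.ne'
  rw [hk, Nat.add_sub_cancel] at hone
  rw [hk]
  have hwM : 0 ≤ w ^ M := (norm_nonneg _).trans (hprodle φ)
  have hden0 : 0 < v * (∏ i ∈ Finset.range N, V i) ^ 2 := by positivity
  have hfin : 1 ≤ w ^ M * (B / (v * (∏ i ∈ Finset.range N, V i) ^ 2)) * (B * w ^ M) ^ k := by
    refine hone.trans ?_
    gcongr
    rw [hφz, norm_mul, norm_neg]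
    exact mul_le_mul (hprodle φ) hΛle (norm_nonneg _) hwM
  have e : w ^ M * (B / (v * (∏ i ∈ Finset.range N, V i) ^ 2)) * (B * w ^ M) ^ k =
      (B * w ^ M) ^ (k + 1) / (v * (∏ i ∈ Finset.range N, V i) ^ 2) := by
    rw [pow_succ]; ring
  rw [e, le_div_iff₀ hden0, one_mul] at hfin
  exact hfin

/-! ### Consequences of the growth hypotheses -/

theorem exists_forall_le_mul_of_eventually {f g : ℕ → ℝ} (hg : ∀ i, 1 ≤ g i) {C : ℝ}
    (h : ∀ᶠ i in atTop, f i ≤ C * g i) : ∃ C', 0 ≤ C' ∧ ∀ i, f i ≤ C' * g i := by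
  obtain ⟨n0, hn0⟩ := eventually_atTop.1 h
  have hs : 0 ≤ ∑ i ∈ Finset.range n0, |f i| := Finset.sum_nonneg fun _ _ => abs_nonneg _
  refine ⟨|C| + ∑ i ∈ Finset.range n0, |f i|, by positivity, fun i => ?_⟩
  have hgi := hg i
  rcases le_or_gt n0 i with hi | hi
  · have h1 := mul_le_mul_of_nonneg_right (le_abs_self C) (by linarith : 0 ≤ g i)
    have h2 : 0 ≤ (∑ i ∈ Finset.range n0, |f i|) * g i := by positivity
    linarith [hn0 i hi]
  · have h1 : |f i| ≤ ∑ i ∈ Finset.range n0, |f i| :=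
      Finset.single_le_sum (f := fun i => |f i|) (fun _ _ => abs_nonneg _) (Finset.mem_range.2 hi)
    have h2 : 0 ≤ |C| * g i := by positivity
    nlinarith [le_abs_self (f i)]

/-- The `liminf` hypothesis on consecutive sequences, made effective and extended to all pairs. -/
theorem exists_eventually_mul_le_of_liminf {M : ℕ} {a : ℕ → Fin M → ℝ}
    (hone : ∀ n, 1 ≤ n → ∀ j, 1 ≤ a n j)
    (hliminf : ∀ (j : ℕ) (hj : j + 1 < M),
      (0 : EReal) < liminf (fun n : ℕ =>
        ((√(n : ℝ) * (a n ⟨j, (Nat.lt_succ_self j).trans hj⟩ / a n ⟨j + 1, hj⟩ - 1) : ℝ) : EReal))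
        atTop) {j j' : Fin M} (hjj' : j < j') :
    ∃ κ : ℝ, 0 < κ ∧ ∀ᶠ i : ℕ in atTop, (1 + κ / √((i : ℝ) + 1)) * a (i + 1) j' ≤ a (i + 1) j := by
  have cons : ∀ (j : ℕ) (hj : j + 1 < M), ∃ κ : ℝ, 0 < κ ∧ ∀ᶠ i : ℕ in atTop,
      (1 + κ / √((i : ℝ) + 1)) * a (i + 1) ⟨j + 1, hj⟩ ≤
        a (i + 1) ⟨j, (Nat.lt_succ_self j).trans hj⟩ := by
    intro j hj
    obtain ⟨κ, hκ0, hκ⟩ := EReal.lt_iff_exists_real_btwn.1 (hliminf j hj)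
    refine ⟨κ, by exact_mod_cast hκ0, ?_⟩
    have ev := (tendsto_add_atTop_nat 1).eventually (eventually_lt_of_lt_liminf hκ)
    filter_upwards [ev] with i hi
    have hpos : 0 < a (i + 1) ⟨j + 1, hj⟩ := by linarith [hone (i + 1) (by omega) ⟨j + 1, hj⟩]
    rw [EReal.coe_lt_coe_iff] at hi
    push_cast at hi
    have hs : 0 < √((i : ℝ) + 1) := Real.sqrt_pos.2 (by positivity)
    rw [← le_div_iff₀ hpos]
    rw [mul_comm, ← div_lt_iff₀ hs] at hi
    linarith
  have main : ∀ (k j : ℕ) (hj : j + k + 1 < M), ∃ κ : ℝ, 0 < κ ∧ ∀ᶠ i : ℕ in atTop,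
      (1 + κ / √((i : ℝ) + 1)) * a (i + 1) ⟨j + k + 1, hj⟩ ≤
        a (i + 1) ⟨j, by omega⟩ := by
    intro k
    induction k with
    | zero => exact cons
    | succ k ih =>
      -- of the two factors, that of the induction hypothesis is kept, the last one only used as `≥ 1`
      intro j hj
      obtain ⟨κ, hκ, h1⟩ := ih j (by omega)
      obtain ⟨κ', hκ', h2⟩ := cons (j + k + 1) hj
      refine ⟨κ, hκ, ?_⟩
      filter_upwards [h1, h2] with i h1 h2
      refine le_trans ?_ h1
      gcongr
      refine le_trans (le_mul_of_one_le_left ?_ ?_) h2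
      · linarith [hone (i + 1) (by omega) ⟨j + (k + 1) + 1, hj⟩]
      · have : 0 ≤ κ' / √((i : ℝ) + 1) := by positivity
        linarith
  have hlt : (j : ℕ) < j' := hjj'
  obtain ⟨k, hk⟩ := Nat.exists_eq_add_of_lt hlt
  have hj' : j' = ⟨j + k + 1, by omega⟩ := Fin.ext hk
  rw [hj']
  exact main k j _

/-- The inequality of `mul_prod_sq_le_of_relation` in terms of logarithms. -/
theorem le_of_two_rpow_mul_prod_le {L g : ℕ → ℝ} {C B : ℝ} {M D N : ℕ} (hN : 1 ≤ N)
    (hg : ∀ i, 1 ≤ g i) (hB : 1 ≤ B)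
    (h : (2 : ℝ) ^ L N * (∏ i ∈ Finset.range N, (2 : ℝ) ^ (L i - C * g i)) ^ 2 ≤
      (B * (∏ i ∈ Finset.range N, (2 : ℝ) ^ (L i + C * g i)) ^ M) ^ D) :
    L N ≤ (D * M - 2) * ∑ i ∈ Finset.range N, L i +
      ((D * M + 2) * C + D * Real.logb 2 B) * ∑ i ∈ Finset.range N, g i := by
  have hB' : B = (2 : ℝ) ^ Real.logb 2 B :=
    (Real.rpow_logb two_pos (by norm_num) (by linarith)).symm
  have hb0 : 0 ≤ Real.logb 2 B := Real.logb_nonneg (by norm_num) hB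
  have hG : 1 ≤ ∑ i ∈ Finset.range N, g i :=
    (hg 0).trans (Finset.single_le_sum (fun i _ => by linarith [hg i])
      (Finset.mem_range.2 hN))
  have pw : ∀ (y : ℝ) (k : ℕ), ((2 : ℝ) ^ y) ^ k = (2 : ℝ) ^ (y * k) := fun y k => by
    rw [Real.rpow_mul two_pos.le, Real.rpow_natCast]
  rw [hB', ← Real.rpow_sum_of_pos two_pos, ← Real.rpow_sum_of_pos two_pos, pw, pw,
    ← Real.rpow_add two_pos, ← Real.rpow_add two_pos, pw,
    Real.rpow_le_rpow_left_iff one_lt_two, Finset.sum_sub_distrib, Finset.sum_add_distrib,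
    ← Finset.mul_sum] at h
  push_cast at h
  have h1 : D * Real.logb 2 B * 1 ≤ D * Real.logb 2 B * ∑ i ∈ Finset.range N, g i := by gcongr
  linarith

/-- If `L N` is `O(d ^ N)` and `log₂ (a (N + 1))` exceeds `L N` by at most the error term, then
`a n ^ (1 / d ^ n)` is bounded. -/
theorem limsup_rpow_lt_top {d : ℕ} (hd : 2 ≤ d) {γ : ℝ} (hγ0 : 0 < γ) (hγ1 : γ < 1)
    {L : ℕ → ℝ} (hL : ∀ i, 0 ≤ L i) {B C : ℝ} (hC : 0 ≤ C) (hB : ∀ N, L N ≤ B * (d : ℝ) ^ N)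
    {a : ℕ → ℝ} (ha : ∀ i, 1 ≤ a (i + 1))
    (hLa : ∀ i, Real.logb 2 (a (i + 1)) ≤
      L i + C * (L i ^ γ + (d : ℝ) ^ (((i : ℝ) + 1) * γ))) :
    limsup (fun n : ℕ => ((a n ^ (1 / (d : ℝ) ^ n) : ℝ) : EReal)) atTop < ⊤ := by
  have hd1 : (1 : ℝ) ≤ d := by exact_mod_cast (by omega : 1 ≤ d)
  have hd0 : (0 : ℝ) < d := by linarith
  set B' := max B 0
  refine lt_of_le_of_lt (b := (((2 : ℝ) ^ (B' + C * (2 + B')) : ℝ) : EReal)) ?_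
    (EReal.coe_lt_top _)
  refine limsup_le_of_le ?_ ?_
  · isBoundedDefault
  filter_upwards [eventually_ge_atTop 1] with n hn
  obtain ⟨i, rfl⟩ : ∃ i, n = i + 1 := ⟨n - 1, by omega⟩
  rw [EReal.coe_le_coe_iff]
  have hpos : 0 < a (i + 1) := by linarith [ha i]
  have hdi : 1 ≤ (d : ℝ) ^ (i + 1) := one_le_pow₀ hd1
  have h0 : 0 ≤ B' := le_max_right _ _
  have h1 : L i ≤ B' * (d : ℝ) ^ (i + 1) := by
    refine (hB i).trans (mul_le_mul (le_max_left _ _) ?_ (by positivity) h0)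
    exact pow_le_pow_right₀ hd1 (by omega)
  have h2 : L i ^ γ ≤ 1 + L i := by
    calc L i ^ γ ≤ (1 + L i) ^ γ := Real.rpow_le_rpow (hL i) (by linarith) hγ0.le
      _ ≤ (1 + L i) ^ (1 : ℝ) := Real.rpow_le_rpow_of_exponent_le (by linarith [hL i]) hγ1.le
      _ = 1 + L i := Real.rpow_one _
  have h3 : (d : ℝ) ^ (((i : ℝ) + 1) * γ) ≤ (d : ℝ) ^ (i + 1) := by
    rw [← Real.rpow_natCast]
    apply Real.rpow_le_rpow_of_exponent_le hd1
    push_cast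
    have : (0 : ℝ) ≤ (i : ℝ) + 1 := by positivity
    nlinarith
  have h4 : Real.logb 2 (a (i + 1)) ≤ (B' + C * (2 + B')) * (d : ℝ) ^ (i + 1) := by
    refine (hLa i).trans ?_
    have : C * (L i ^ γ + (d : ℝ) ^ (((i : ℝ) + 1) * γ)) ≤
        C * ((2 + B') * (d : ℝ) ^ (i + 1)) := by
      gcongr
      linarith
    linarith
  rw [← Real.rpow_logb two_pos (by norm_num) hpos, ← Real.rpow_mul two_pos.le]
  apply Real.rpow_le_rpow_of_exponent_le one_le_two
  rw [mul_one_div, div_le_iff₀ (by positivity)]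
  exact h4

/-- The partial quotients of all the continued fractions agree up to a factor
`2 ^ (C ((L i) ^ γ + d ^ ((i + 1) γ)))`, where `L i` is the logarithm of those of the last one. -/
theorem exists_abs_logb_sub_le {M : ℕ} (hM : 1 ≤ M) {γ : ℝ} {d : ℕ} (hd : 2 ≤ d) (hγ0 : 0 < γ)
    {a : ℕ → Fin M → ℝ} (hone : ∀ n, 1 ≤ n → ∀ j, 1 ≤ a n j)
    (hfirst_last : ∀ n, 1 ≤ n → a n ⟨0, hM⟩ <
      max (a n ⟨M - 1, Nat.sub_lt hM one_pos⟩ *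
            (2 : ℝ) ^ (Real.logb 2 (a n ⟨M - 1, Nat.sub_lt hM one_pos⟩) ^ γ))
        ((2 : ℝ) ^ ((d : ℝ) ^ ((n : ℝ) * γ))))
    (hord : ∀ j j' : Fin M, j ≤ j' → ∀ᶠ i : ℕ in atTop, a (i + 1) j' ≤ a (i + 1) j)
    {L g : ℕ → ℝ}
    (hL : ∀ i, L i = Real.logb 2 (a (i + 1) ⟨M - 1, Nat.sub_lt hM one_pos⟩))
    (hg : ∀ i, g i = L i ^ γ + (d : ℝ) ^ (((i : ℝ) + 1) * γ)) :
    ∃ C : ℝ, 0 ≤ C ∧ ∀ j i, |Real.logb 2 (a (i + 1) j) - L i| ≤ C * g i := by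
  have hd1 : (1 : ℝ) ≤ d := by exact_mod_cast (by omega : 1 ≤ d)
  have hL0 : ∀ i, 0 ≤ L i := fun i => by
    rw [hL]; exact Real.logb_nonneg one_lt_two (hone _ (by omega) _)
  have hg1 : ∀ i, 1 ≤ g i := fun i => by
    have h1 := Real.rpow_nonneg (hL0 i) γ
    have h2 : 1 ≤ (d : ℝ) ^ (((i : ℝ) + 1) * γ) := Real.one_le_rpow hd1 (by positivity)
    rw [hg]; linarith
  have hlast : ∀ i, a (i + 1) ⟨M - 1, Nat.sub_lt hM one_pos⟩ = (2 : ℝ) ^ L i := fun i => by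
    rw [hL, Real.rpow_logb two_pos (by norm_num)]
    linarith [hone (i + 1) (by omega) ⟨M - 1, Nat.sub_lt hM one_pos⟩]
  have hfirst : ∀ i, a (i + 1) ⟨0, hM⟩ ≤ (2 : ℝ) ^ (L i + g i) := by
    intro i
    refine (hfirst_last (i + 1) (by omega)).le.trans (max_le ?_ ?_)
    · rw [← hL, hlast, ← Real.rpow_add two_pos]
      apply Real.rpow_le_rpow_of_exponent_le one_le_two
      have : 0 ≤ (d : ℝ) ^ (((i : ℝ) + 1) * γ) := by positivity
      linarith [hg i]
    · apply Real.rpow_le_rpow_of_exponent_le one_le_two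
      push_cast
      have := Real.rpow_nonneg (hL0 i) γ
      linarith [hg i, hL0 i]
  have hcomp : ∀ j, ∀ᶠ i in atTop, |Real.logb 2 (a (i + 1) j) - L i| ≤ 1 * g i := by
    intro j
    filter_upwards [hord ⟨0, hM⟩ j (Nat.zero_le _),
      hord j ⟨M - 1, Nat.sub_lt hM one_pos⟩ (Nat.le_sub_one_of_lt j.2)] with i h1 h2
    have hp : 0 < a (i + 1) j := by linarith [hone (i + 1) (by omega) j]
    rw [hlast, ← Real.le_logb_iff_rpow_le one_lt_two hp] at h2
    have h3 := h1.trans (hfirst i)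
    rw [← Real.logb_le_iff_le_rpow one_lt_two hp] at h3
    rw [one_mul, abs_of_nonneg (by linarith)]
    linarith
  choose C hC0 hC using fun j => exists_forall_le_mul_of_eventually hg1 (hcomp j)
  refine ⟨∑ j, C j, Finset.sum_nonneg fun j _ => hC0 j, fun j i => (hC j i).trans ?_⟩
  have := hg1 i
  gcongr
  exact Finset.single_le_sum (fun j _ => hC0 j) (Finset.mem_univ j)

/-- `growthBound` stays within the error term when its argument is replaced by a comparable one. -/
theorem growthBound_le_two_rpow {d : ℕ} {γ : ℝ} (hγ0 : 0 < γ) (hγ1 : γ < 1) {i : ℕ} {x l C : ℝ}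
    (hl : 0 ≤ l) (hC : 0 ≤ C) (hx : 1 ≤ x) (hd : 2 ≤ d)
    (h : |Real.logb 2 x - l| ≤ C * (l ^ γ + (d : ℝ) ^ (((i : ℝ) + 1) * γ))) :
    growthBound d γ (i + 1) x ≤
      (2 : ℝ) ^ ((C + 2) * (l ^ γ + (d : ℝ) ^ (((i : ℝ) + 1) * γ))) := by
  have hd1 : (1 : ℝ) ≤ d := by exact_mod_cast (by omega : 1 ≤ d)
  have h1 : 1 ≤ (d : ℝ) ^ (((i : ℝ) + 1) * γ) := Real.one_le_rpow hd1 (by positivity)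
  have h2 := Real.rpow_nonneg hl γ
  have hx0 := Real.logb_nonneg one_lt_two hx
  set G := l ^ γ + (d : ℝ) ^ (((i : ℝ) + 1) * γ) with hG
  have hG1 : 1 ≤ G := by linarith
  rw [growthBound]
  refine max_le ?_ ?_ <;> apply Real.rpow_le_rpow_of_exponent_le one_le_two
  · have hCG : 0 ≤ C * G := by positivity
    calc Real.logb 2 x ^ γ ≤ (l + (1 + C * G)) ^ γ := by
          apply Real.rpow_le_rpow hx0 _ hγ0.le
          linarith [le_abs_self (Real.logb 2 x - l)]
      _ ≤ l ^ γ + (1 + C * G) ^ γ :=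
          Real.rpow_add_le_add_rpow hl (by positivity) hγ0.le hγ1.le
      _ ≤ l ^ γ + (1 + C * G) ^ (1 : ℝ) := by
          gcongr
          linarith
      _ ≤ (C + 2) * G := by rw [Real.rpow_one]; linarith
  · push_cast
    have : 0 ≤ C * G := by positivity
    linarith

/-! ### Linear independence -/

/-- A relation with integral coefficients forces the recursion of `exists_le_mul_pow_of_le_sum`
for the logarithms of the partial quotients. -/
theorem exists_eventually_le_of_relation {K : Type*} [Field K] [NumberField K] (φ : K →+* ℂ)
    {M : ℕ} {x δ : Fin M → ℕ → K} {xr : Fin M → ℕ → ℝ} (hφ : ∀ j i, φ (x j i) = (xr j i : ℂ))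
    (hxr : ∀ j i, 1 ≤ xr j i) (hδ0 : ∀ j i, δ j i ≠ 0) (hδ : ∀ j i, IsIntegral ℤ (δ j i))
    (hδx : ∀ j i, IsIntegral ℤ (δ j i * x j i)) {α : Fin M → ℝ}
    (hα : ∀ j n, |α j - contNum (xr j) n / contDen (xr j) n| ≤
        1 / (contDen (xr j) n * contDen (xr j) (n + 1)) ∧
      1 / (2 * (contDen (xr j) n * contDen (xr j) (n + 1))) ≤
        |α j - contNum (xr j) n / contDen (xr j) n|)
    (hgrow : ∀ j j' : Fin M, j < j' →
      Tendsto (fun n => contDen (xr j) n / contDen (xr j') n) atTop atTop)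
    {L g : ℕ → ℝ} {C : ℝ} (hg : ∀ i, 1 ≤ g i)
    (hLx : ∀ j i, (2 : ℝ) ^ (L i - C * g i) ≤ xr j i)
    (hL : ∀ᶠ i in atTop, ∀ j, (2 : ℝ) ^ L i ≤ xr j i)
    (hconj : ∀ (σ : K →+* ℂ) j i,
      ‖σ (δ j i)‖ * (‖σ (x j i)‖ + 1) ≤ (2 : ℝ) ^ (L i + C * g i))
    {β0 : K} {β : Fin M → K} (hβ0 : IsIntegral ℤ β0) (hβ : ∀ j, IsIntegral ℤ (β j))
    (hβne : ∃ j, β j ≠ 0) (hrel : φ β0 + ∑ j, φ (β j) * (α j : ℂ) = 0) :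
    ∃ C' : ℝ, ∀ᶠ N : ℕ in atTop,
      L N ≤ (Module.finrank ℚ K * M - 2) * ∑ i ∈ Finset.range N, L i +
        C' * ∑ i ∈ Finset.range N, g i := by
  set B := max 1 (house β0 + ∑ j, house (β j)) with hB
  have hne : ∃ j, φ (β j) ≠ 0 := hβne.imp fun j hj => (map_ne_zero φ).2 hj
  refine ⟨(Module.finrank ℚ K * M + 2) * C + Module.finrank ℚ K * Real.logb 2 B, ?_⟩
  filter_upwards [eventually_sum_mul_sub_ne_zero hxr hα hgrow hne, hL, eventually_ge_atTop 1]
    with N hN hLN hN1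
  refine le_of_two_rpow_mul_prod_le hN1 hg (le_max_left _ _) ?_
  exact mul_prod_sq_le_of_relation φ hφ hxr hδ0 hδ hδx (fun j n => (hα j n).1) hβ0 hβ hrel
    (fun i => Real.rpow_pos_of_pos two_pos _) hLx hconj (le_max_right _ _) hN
    (Real.rpow_pos_of_pos two_pos _) hLN

/-- A nontrivial relation can be rescaled to have integral coefficients. -/
theorem exists_integral_relation {K : Type*} [Field K] [NumberField K] (φ : K →+* ℂ) {M : ℕ}
    {α : Fin M → ℝ} {β0 : K} {β : Fin M → K} (hβne : ∃ j, β j ≠ 0)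
    (hrel : φ β0 + ∑ j, φ (β j) * (α j : ℂ) = 0) :
    ∃ (β0' : K) (β' : Fin M → K), IsIntegral ℤ β0' ∧ (∀ j, IsIntegral ℤ (β' j)) ∧
      (∃ j, β' j ≠ 0) ∧ φ β0' + ∑ j, φ (β' j) * (α j : ℂ) = 0 := by
  obtain ⟨m, hm⟩ := IsLocalization.exist_integer_multiples (nonZeroDivisors (𝓞 K)) Finset.univ
    (Fin.cons β0 β : Fin (M + 1) → K)
  have hm0 : ((m : 𝓞 K) : K) ≠ 0 := by
    have := nonZeroDivisors.coe_ne_zero m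
    exact_mod_cast this
  have hint : ∀ i, IsIntegral ℤ (((m : 𝓞 K) : K) * (Fin.cons β0 β : Fin (M + 1) → K) i) := by
    intro i
    obtain ⟨y, hy⟩ := hm i (Finset.mem_univ i)
    rw [Algebra.smul_def] at hy
    exact hy ▸ y.isIntegral_coe
  refine ⟨(m : 𝓞 K) * β0, fun j => (m : 𝓞 K) * β j, by simpa using hint 0,
    fun j => by simpa using hint j.succ, hβne.imp fun j hj => mul_ne_zero hm0 hj, ?_⟩
  calc φ ((m : 𝓞 K) * β0) + ∑ j, φ ((m : 𝓞 K) * β j) * (α j : ℂ)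
      = φ (m : 𝓞 K) * (φ β0 + ∑ j, φ (β j) * (α j : ℂ)) := by
        rw [mul_add, Finset.mul_sum, map_mul]
        congr 1
        exact Finset.sum_congr rfl fun j _ => by rw [map_mul, mul_assoc]
    _ = 0 := by rw [hrel, mul_zero]

theorem theorem2 (D M : ℕ) (hM : 1 ≤ M) (γ : ℝ) (hγ0 : 0 < γ) (hγ1 : γ < 1)
    (K : Subfield ℂ) [NumberField K] (hD : Module.finrank ℚ K = D)
    (d : ℕ) (hd : d = max 2 (D * M - 1))
    (S : ℕ → Fin M → ℤ) (b c den : ℕ → Fin M → 𝓞 K)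
    -- the real numbers `a n j`, and the same numbers as elements `aK n j` of `K`
    (a : ℕ → Fin M → ℝ) (aK : ℕ → Fin M → K)
    (haK : ∀ n j, ((aK n j : K) : ℂ) = ((a n j : ℝ) : ℂ))
    (hquot : ∀ n, 1 ≤ n → ∀ j,
      aK n j = ((S n j : K) * (b n j : K) + (c n j : K)) / (den n j : K))
    (hone : ∀ n, 1 ≤ n → ∀ j, 1 ≤ a n j)
    -- either the house condition or the condition on real parts
    (hconj : (∀ n, 1 ≤ n → ∀ j, house (1 / aK n j) ≤ 1 / 2) ∨
      (∃ e : Fin M → (K →+* ℂ) → Fin 2, ∀ n, 1 ≤ n → ∀ (j : Fin M) (σ : K →+* ℂ),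
        (growthBound d γ n (a n ⟨0, hM⟩))⁻¹ ≤ (-1 : ℝ) ^ (e j σ : ℕ) * (σ (aK n j)).re))
    (hfirst_last : ∀ n, 1 ≤ n → a n ⟨0, hM⟩ <
      max (a n ⟨M - 1, Nat.sub_lt hM one_pos⟩ *
            (2 : ℝ) ^ (Real.logb 2 (a n ⟨M - 1, Nat.sub_lt hM one_pos⟩) ^ γ))
        ((2 : ℝ) ^ ((d : ℝ) ^ ((n : ℝ) * γ))))
    (hhouse : ∀ n, 1 ≤ n → ∀ j,
      house (b n j : K) ≤ growthBound d γ n (a n j) ∧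
      house (c n j : K) ≤ growthBound d γ n (a n j) ∧
      house (den n j : K) ≤ growthBound d γ n (a n j))
    (hliminf : ∀ (j : ℕ) (hj : j + 1 < M),
      (0 : EReal) < liminf (fun n : ℕ =>
        ((√(n : ℝ) * (a n ⟨j, (Nat.lt_succ_self j).trans hj⟩ / a n ⟨j + 1, hj⟩ - 1) : ℝ) : EReal))
        atTop)
    (hlimsup : ∃ j : Fin M,
      limsup (fun n : ℕ => ((a n j ^ (1 / (d : ℝ) ^ n) : ℝ) : EReal)) atTop = ⊤) :
    ∃ α : Fin M → ℝ, (∀ j, IsContFracValue (fun n => a n j) (α j)) ∧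
      LinearIndependent K (Fin.cons (1 : ℂ) (fun j => ((α j : ℝ) : ℂ)) : Fin (M + 1) → ℂ) := by
  have hd2 : 2 ≤ d := hd ▸ le_max_left _ _
  have hd1 : (1 : ℝ) ≤ d := by exact_mod_cast (by omega : 1 ≤ d)
  have hxr : ∀ j i, 1 ≤ a (i + 1) j := fun j i => hone (i + 1) (by omega) j
  choose l hl hlb using fun j => exists_contFrac_limit (hxr j)
  refine ⟨fun j => a 0 j + l j, fun j => isContFracValue_add (a := fun n => a n j) (hxr j) (hl j),
    ?_⟩
  -- it suffices to exclude relations between `1` and the fractional continued fractions `l j`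
  suffices hno : ∀ (β0 : K) (β : Fin M → K), (∃ j, β j ≠ 0) →
      K.subtype β0 + ∑ j, K.subtype (β j) * (l j : ℂ) = 0 → False by
    rw [Fintype.linearIndependent_iff]
    intro r hr
    rw [Fin.sum_univ_succ] at hr
    simp only [Fin.cons_zero, Fin.cons_succ, Subfield.smul_def, smul_eq_mul, mul_one] at hr
    have hz : ∀ j : Fin M, r j.succ = 0 := by
      by_contra! hne
      refine hno (r 0 + ∑ j : Fin M, r j.succ * aK 0 j) (fun j => r j.succ) hne ?_
      rw [← hr, map_add, map_sum, add_assoc, ← Finset.sum_add_distrib]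
      congr 1
      refine Finset.sum_congr rfl fun j _ => ?_
      rw [map_mul]
      simp only [Subfield.subtype_apply, haK]
      push_cast
      ring
    intro i
    refine Fin.cases ?_ hz i
    simpa [hz] using hr
  intro β0' β' hne' hrel'
  obtain ⟨β0, β, hβ0, hβ, hne, hrel⟩ := exists_integral_relation K.subtype hne' hrel'
  set last : Fin M := ⟨M - 1, Nat.sub_lt hM one_pos⟩
  obtain ⟨L, hL⟩ : ∃ L : ℕ → ℝ, ∀ i, L i = Real.logb 2 (a (i + 1) last) := ⟨_, fun _ => rfl⟩
  obtain ⟨g, hg⟩ : ∃ g : ℕ → ℝ, ∀ i, g i = L i ^ γ + (d : ℝ) ^ (((i : ℝ) + 1) * γ) :=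
    ⟨_, fun _ => rfl⟩
  have hL0 : ∀ i, 0 ≤ L i := fun i => by
    rw [hL]; exact Real.logb_nonneg one_lt_two (hxr _ _)
  have hg1 : ∀ i, 1 ≤ g i := fun i => by
    have h1 := Real.rpow_nonneg (hL0 i) γ
    have h2 : 1 ≤ (d : ℝ) ^ (((i : ℝ) + 1) * γ) := Real.one_le_rpow hd1 (by positivity)
    rw [hg]; linarith
  have hratio := fun (j j' : Fin M) (h : j < j') =>
    exists_eventually_mul_le_of_liminf hone hliminf h
  have hord : ∀ j j' : Fin M, j ≤ j' → ∀ᶠ i : ℕ in atTop, a (i + 1) j' ≤ a (i + 1) j := by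
    intro j j' hjj'
    rcases hjj'.eq_or_lt with rfl | hlt
    · exact Eventually.of_forall fun _ => le_rfl
    · obtain ⟨κ, hκ, h⟩ := hratio j j' hlt
      filter_upwards [h] with i hi
      refine (le_mul_of_one_le_left (by linarith [hxr j' i]) ?_).trans hi
      have : 0 ≤ κ / √((i : ℝ) + 1) := by positivity
      linarith
  obtain ⟨C, hC0, hC⟩ := exists_abs_logb_sub_le hM hd2 hγ0 hone hfirst_last hord hL hg
  have hpow : ∀ j i, a (i + 1) j = (2 : ℝ) ^ Real.logb 2 (a (i + 1) j) := fun j i =>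
    (Real.rpow_logb two_pos (by norm_num) (by linarith [hxr j i])).symm
  have hG : ∀ j i, growthBound d γ (i + 1) (a (i + 1) j) ≤ (2 : ℝ) ^ ((C + 2) * g i) := by
    intro j i
    rw [hg]
    exact growthBound_le_two_rpow hγ0 hγ1 (hL0 i) hC0 (hxr j i) hd2 (hg i ▸ hC j i)
  have hnorm : ∀ j i, ‖K.subtype (aK (i + 1) j)‖ = a (i + 1) j := by
    intro j i
    rw [Subfield.subtype_apply, haK, Complex.norm_real, Real.norm_of_nonneg]
    linarith [hxr j i]
  have hden0 : ∀ j i, (den (i + 1) j : K) ≠ 0 := by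
    intro j i h0
    have h1 := hquot (i + 1) (by omega) j
    have h2 := hnorm j i
    rw [h1, h0, div_zero, map_zero, norm_zero] at h2
    linarith [hxr j i]
  -- `C + 2` accounts for the factor `4 = 2 ^ 2` and the deviation of `a (i + 1) j` from `2 ^ L i`,
  -- and `(C + 2) * (D + 1)` for the power of `growthBound` in `norm_mul_norm_add_one_le`
  obtain ⟨C', hC'⟩ := exists_eventually_le_of_relation K.subtype
    (x := fun j i => aK (i + 1) j) (δ := fun j i => (den (i + 1) j : K))
    (xr := fun j i => a (i + 1) j) (L := L) (g := g) (C := C + 2 + (C + 2) * (D + 1))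
    (fun j i => haK (i + 1) j) hxr hden0 (fun j i => (den (i + 1) j).isIntegral_coe)
    (fun j i => by
      have h0 := hden0 j i
      rw [hquot (i + 1) (by omega) j, mul_div_cancel₀ _ h0]
      exact ((isIntegral_algebraMap (R := ℤ) (x := S (i + 1) j)).mul
        (b (i + 1) j).isIntegral_coe).add (c (i + 1) j).isIntegral_coe)
    hlb
    (fun j j' h => by
      obtain ⟨κ, hκ, hev⟩ := hratio j j' h
      exact tendsto_contDen_div_contDen (hxr j) (hxr j') hκ hev)
    hg1
    (fun j i => by
      rw [hpow j i]
      apply Real.rpow_le_rpow_of_exponent_le one_le_two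
      have h1 := (abs_le.1 (hC j i)).1
      have h2 : 0 ≤ (2 + (C + 2) * (D + 1)) * g i := by
        have := hg1 i
        positivity
      linarith)
    (by
      rw [eventually_all]
      intro j
      filter_upwards [hord j last (Nat.le_sub_one_of_lt j.2)] with i hi
      rw [hL, ← hpow]
      exact hi)
    (fun σ j i => by
      obtain ⟨hb, hc, hδ⟩ := hhouse (i + 1) (by omega) j
      have h1 := norm_mul_norm_add_one_le (hquot (i + 1) (by omega) j) K.subtype
        (by rw [hnorm]; exact hxr j i)
        (Real.one_le_rpow one_le_two (by have := hg1 i; positivity) : 1 ≤ (2 : ℝ) ^ ((C + 2) * g i))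
        (hb.trans (hG j i)) (hc.trans (hG j i)) (hδ.trans (hG j i)) σ
      refine h1.trans ?_
      rw [hnorm, hD, hpow j i, ← Real.rpow_natCast, ← Real.rpow_mul two_pos.le,
        show (4 : ℝ) = (2 : ℝ) ^ (2 : ℝ) by norm_num, ← Real.rpow_add two_pos,
        ← Real.rpow_add two_pos]
      apply Real.rpow_le_rpow_of_exponent_le one_le_two
      have h2 := (abs_le.1 (hC j i)).2
      push_cast
      linarith [hg1 i])
    hβ0 hβ hne hrel
  -- `D * M - 1` is a truncated difference in the definition of `d`, the difference here is real
  have hDM : (D : ℝ) * M - 2 ≤ d - 1 := by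
    have : D * M ≤ d + 1 := by omega
    have : (D : ℝ) * M ≤ d + 1 := by exact_mod_cast this
    linarith
  obtain ⟨B, hB⟩ := exists_le_mul_pow_of_le_sum hd2 hγ0 hγ1 hL0 (C := C') <| by
    filter_upwards [hC'] with N hN
    simp only [← hg]
    rw [hD] at hN
    refine hN.trans (add_le_add (mul_le_mul_of_nonneg_right hDM ?_) le_rfl)
    exact Finset.sum_nonneg fun i _ => hL0 i
  obtain ⟨j, hj⟩ := hlimsup
  refine (limsup_rpow_lt_top hd2 hγ0 hγ1 hL0 hC0 hB (a := fun n => a n j) (hxr j)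
    fun i => ?_).ne hj
  have := (abs_le.1 (hC j i)).2
  rw [hg] at this
  linarith
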